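/- For $\alpha>0$ and $n\in\mathbb{N}$ let $P_{2n}^{(2)}$ be the Lagrange interpolation polynomial (of degree at most $2n$) of the function $x\mapsto|x|^{\alpha}$ at the $2n+1$ zeros $x_j=\cos\frac{(j-1/2)\pi}{2n+1}$, $j=1,\dots,2n+1$, of the Chebyshev polynomial of the first kind $T_{2n+1}$. For $x\ge 0$ put \[ H(\alpha,x)=\int_0^\infty \frac{t^{\alpha}}{\sinh t}\,\frac{x\sin x}{x^2+t^2}\,dt \] (so that $H(\alpha,0)=0$) and \[ H_\alpha(x)=|x|^{\alpha}-\frac{2}{\pi}\sin\frac{\pi\alpha}{2}\,H(\alpha,x). \] Theorem 3.2. Let $\alpha>0$. Then, uniformly on compact subsets of $[0,\infty)$, \[ \lim_{n\to\infty}(2n)^{\alpha}P_{2n}^{(2)}\!\left(\frac{x}{2n}\right)=H_\alpha(x). \] -/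

import Mathlib

/-- The Chebyshev node `cos ((j - 1/2) π / (2n+1))`, meant for `1 ≤ j ≤ 2n+1`: these are the
`2n+1` zeros of the Chebyshev polynomial `T_{2n+1}`. -/
noncomputable def chebyshevNode (n j : ℕ) : ℝ :=
  Real.cos (((j : ℝ) - 1 / 2) * Real.pi / (2 * (n : ℝ) + 1))

/-- The nodes are pairwise distinct. -/
theorem chebyshevNode_injOn (n : ℕ) :
    Set.InjOn (chebyshevNode n) (Finset.Icc 1 (2 * n + 1) : Finset ℕ) := by
  have hd : (0 : ℝ) < 2 * (n : ℝ) + 1 := by positivity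
  have key : ∀ j ∈ (Finset.Icc 1 (2 * n + 1) : Finset ℕ),
      ((j : ℝ) - 1 / 2) * Real.pi / (2 * (n : ℝ) + 1) ∈ Set.Icc 0 Real.pi := by
    intro j hj
    obtain ⟨h1, h2⟩ := Finset.mem_Icc.1 hj
    have h1' : (1 : ℝ) ≤ j := by exact_mod_cast h1
    have h2' : (j : ℝ) ≤ 2 * n + 1 := by exact_mod_cast h2
    constructor
    · have : (0 : ℝ) ≤ (j : ℝ) - 1 / 2 := by linarith
      positivity
    · rw [div_le_iff₀ hd]
      nlinarith [Real.pi_pos]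
  intro i hi j hj hij
  have h := Real.injOn_cos (key i hi) (key j hj) hij
  rw [div_left_inj' hd.ne', mul_left_inj' Real.pi_ne_zero] at h
  have h' : (i : ℝ) = j := by linarith
  exact_mod_cast h'

/-- The nodes are zeros of the Chebyshev polynomial `T_{2n+1}`. -/
theorem chebyshevNode_isRoot (n j : ℕ) :
    (Polynomial.Chebyshev.T ℝ (2 * (n : ℤ) + 1)).IsRoot (chebyshevNode n j) := by
  have hd : (2 * (n : ℝ) + 1) ≠ 0 := by positivity
  rw [Polynomial.IsRoot, chebyshevNode, Polynomial.Chebyshev.T_real_cos, Real.cos_eq_zero_iff]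
  refine ⟨(j : ℤ) - 1, ?_⟩
  push_cast
  field_simp
  ring

/-- The Lagrange interpolation polynomial (of degree at most `2n`) of `x ↦ |x|^α` at the
`2n+1` zeros of the Chebyshev polynomial `T_{2n+1}`. -/
noncomputable def interpPoly (α : ℝ) (n : ℕ) : Polynomial ℝ :=
  Lagrange.interpolate (Finset.Icc 1 (2 * n + 1)) (chebyshevNode n)
    (fun j => |chebyshevNode n j| ^ α)

/-- `H(α, x) = ∫₀^∞ (t^α / sinh t) (x sin x / (x² + t²)) dt`. The integrand vanishes for `x = 0`,
so that `H(α, 0) = 0`. -/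
noncomputable def bigH (α x : ℝ) : ℝ :=
  ∫ t in Set.Ioi (0 : ℝ), t ^ α / Real.sinh t * (x * Real.sin x / (x ^ 2 + t ^ 2))

/-- The integral defining `H(α, x)` converges absolutely for all `α > 0`. -/
theorem bigH_integrableOn (α x : ℝ) (hα : 0 < α) :
    MeasureTheory.IntegrableOn
      (fun t : ℝ => t ^ α / Real.sinh t * (x * Real.sin x / (x ^ 2 + t ^ 2))) (Set.Ioi 0) := by
  rcases eq_or_ne x 0 with rfl | hx
  · simp
  have hx2 : 0 < x ^ 2 := by positivity
  have h0 : MeasureTheory.IntegrableOn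
      (fun t : ℝ => t ^ (α - 1) * Real.exp (-(1 / 2) * t)) (Set.Ioi 0) := by
    have := integrableOn_rpow_mul_exp_neg_mul_rpow (s := α - 1) (p := 1) (b := 1 / 2)
      (by linarith) one_pos (by norm_num)
    simpa using this
  have h1 := h0.mul_const (2 * (|x * Real.sin x| / x ^ 2))
  refine MeasureTheory.Integrable.mono' h1 ?_ ?_
  · exact Measurable.aestronglyMeasurable (by fun_prop)
  · filter_upwards [MeasureTheory.ae_restrict_mem measurableSet_Ioi] with t ht
    have ht : 0 < t := ht
    have hs : 0 < Real.sinh t := Real.sinh_pos_iff.2 ht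
    have hsinh : t * Real.exp (1 / 2 * t) / 2 ≤ Real.sinh t := by
      have e1 : Real.sinh t = 2 * Real.sinh (t / 2) * Real.cosh (t / 2) := by
        rw [← Real.sinh_two_mul]; ring_nf
      have e2 : t / 2 ≤ Real.sinh (t / 2) := Real.self_le_sinh_iff.2 (by linarith)
      have e3 : Real.exp (t / 2) / 2 ≤ Real.cosh (t / 2) := by
        rw [Real.cosh_eq]; linarith [Real.exp_pos (-(t / 2))]
      have e4 : t / 2 * (Real.exp (t / 2) / 2) ≤ Real.sinh (t / 2) * Real.cosh (t / 2) :=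
        mul_le_mul e2 e3 (by positivity) (by linarith)
      rw [e1, show 1 / 2 * t = t / 2 by ring]
      linarith
    have hA : t ^ α / Real.sinh t ≤ t ^ (α - 1) * Real.exp (-(1 / 2) * t) * 2 := by
      rw [div_le_iff₀ hs]
      have e5 : t ^ α = t ^ (α - 1) * t := by
        rw [← Real.rpow_add_one ht.ne']; ring_nf
      have e6 : Real.exp (-(1 / 2) * t) * Real.exp (1 / 2 * t) = 1 := by
        rw [← Real.exp_add]; simp
      have e7 : 0 ≤ t ^ (α - 1) * Real.exp (-(1 / 2) * t) * 2 := by positivity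
      calc t ^ α = t ^ (α - 1) * Real.exp (-(1 / 2) * t) * 2
            * (t * Real.exp (1 / 2 * t) / 2) := by
              rw [e5]; linear_combination (-(t ^ (α - 1) * t)) * e6
        _ ≤ _ := mul_le_mul_of_nonneg_left hsinh e7
    have hB : |x * Real.sin x / (x ^ 2 + t ^ 2)| ≤ |x * Real.sin x| / x ^ 2 := by
      rw [abs_div, abs_of_pos (by positivity : 0 < x ^ 2 + t ^ 2)]
      exact div_le_div_of_nonneg_left (abs_nonneg _) hx2 (by nlinarith [sq_nonneg t])
    rw [Real.norm_eq_abs, abs_mul, abs_of_nonneg (by positivity : 0 ≤ t ^ α / Real.sinh t),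
      ← mul_assoc]
    exact mul_le_mul hA hB (abs_nonneg _) (by positivity)

/-- `H_α(x) = |x|^α - (2/π) sin(πα/2) H(α, x)`. -/
noncomputable def limitH (α x : ℝ) : ℝ :=
  |x| ^ α - 2 / Real.pi * Real.sin (Real.pi * α / 2) * bigH α x

/-! Write α = 2m + β with 0 ≤ β < 2. For β > 0, |x|^α is a superposition over t > 0 of the rational
functions x^(2m+2) / (x² + t²) (`abs_rpow_eq_integral`), and interpolation is linear, so it suffices
to know the error for each of these. That error is explicit (`interp_error_rational`): x T_{2n+1}(x)
= W(x²) vanishes at the nodes, and subtracting the right multiple of W(x²) from x^(2m+2) makes the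
difference divisible by x² + t². The multiple involves W(-t²), which is where sinh((2n+1) arsinh t)
comes from. For β = 0 the interpolation is eventually exact and the factor sin(πα/2) vanishes.
Rescaling x and t by 2n gives an exact error formula of the same shape as H(α, x), with sinh s
replaced by sinh((2n+1) arsinh(s/2n)) and sin x by sin((2n+1) arcsin(x/2n)). The first replacement
is controlled in L¹ by dominated convergence, independently of x; the second is controlled relative
to x, which gives uniformity down to x = 0. -/

/-! ### Odd Chebyshev polynomials as polynomials in x² -/

open Polynomial in
/-- The polynomial `W` with `W(x²) = x T_{2n+1}(x)`. -/
noncomputable def oddChebyshevSq (n : ℕ) : ℝ[X] :=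
  C (1 / 2) * ((Chebyshev.T ℝ ((n : ℤ) + 1)).comp (2 * X - 1) +
    (Chebyshev.T ℝ (n : ℤ)).comp (2 * X - 1))

-- Since T_k(2y² - 1) = T_{2k}(y), this is the recurrence T_{2n+2} + T_{2n} = 2y T_{2n+1}.
open Polynomial in
theorem eval_sq_oddChebyshevSq (n : ℕ) (y : ℝ) :
    (oddChebyshevSq n).eval (y ^ 2) = y * (Chebyshev.T ℝ (2 * (n : ℤ) + 1)).eval y := by
  have h (k : ℤ) : (Chebyshev.T ℝ k).eval (2 * y ^ 2 - 1) = (Chebyshev.T ℝ (k * 2)).eval y := by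
    rw [Chebyshev.T_mul]
    simp [Chebyshev.T_two]
  have h2 := congrArg (eval y) (Chebyshev.T_add_two ℝ (2 * (n : ℤ)))
  simp only [eval_sub, eval_mul, eval_ofNat, eval_X] at h2
  simp only [oddChebyshevSq, eval_mul, eval_C, eval_add, eval_comp, eval_sub, eval_ofNat, eval_X,
    eval_one]
  rw [h, h, show ((n : ℤ) + 1) * 2 = 2 * n + 2 by ring, show (n : ℤ) * 2 = 2 * n by ring, h2]
  ring

-- Plays the role of evaluating x T_{2n+1}(x) at x = i sinh θ without complex numbers: 2(-sinh² θ) -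
-- 1 = -cosh 2θ, and parity turns the sum of the two T's into a difference of cosh's.
open Polynomial in
theorem eval_neg_sinh_sq_oddChebyshevSq (n : ℕ) (θ : ℝ) :
    (oddChebyshevSq n).eval (-Real.sinh θ ^ 2) =
      (-1) ^ (n + 1) * (Real.sinh θ * Real.sinh ((2 * n + 1) * θ)) := by
  have harg : 2 * (-Real.sinh θ ^ 2) - 1 = -Real.cosh (2 * θ) := by
    rw [Real.cosh_two_mul, Real.cosh_sq]; ring
  have hsign (k : ℕ) : (((k : ℤ).negOnePow : ℤ) : ℝ) = (-1) ^ k := by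
    rw [Int.negOnePow_def]; simp
  simp only [oddChebyshevSq, eval_mul, eval_C, eval_add, eval_comp, eval_sub, eval_ofNat, eval_X,
    eval_one]
  rw [harg, Chebyshev.T_eval_neg, Chebyshev.T_eval_neg, Chebyshev.T_real_cosh,
    Chebyshev.T_real_cosh, ← Nat.cast_succ, hsign, hsign]
  push_cast
  rw [show ((n : ℝ) + 1) * (2 * θ) = (2 * n + 1) * θ + θ by ring,
    show (n : ℝ) * (2 * θ) = (2 * n + 1) * θ - θ by ring, Real.cosh_add, Real.cosh_sub, pow_succ]
  ring

open Polynomial in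
theorem natDegree_oddChebyshevSq_le (n : ℕ) : (oddChebyshevSq n).natDegree ≤ n + 1 := by
  have hlin : (2 * X - 1 : ℝ[X]).natDegree ≤ 1 := by
    compute_degree
  have hcomp (k : ℤ) (hk : k.natAbs ≤ n + 1) :
      ((Chebyshev.T ℝ k).comp (2 * X - 1)).natDegree ≤ n + 1 := by
    refine natDegree_comp_le.trans ?_
    rw [Chebyshev.natDegree_T]
    calc _ ≤ k.natAbs * 1 := Nat.mul_le_mul_left _ hlin
      _ ≤ _ := by omega
  refine (natDegree_C_mul_le _ _).trans (natDegree_add_le_of_degree_le ?_ ?_)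
  · exact hcomp _ (by omega)
  · exact hcomp _ (by omega)

theorem eval_chebyshevT_odd_sin (n : ℕ) (φ : ℝ) :
    (Polynomial.Chebyshev.T ℝ (2 * (n : ℤ) + 1)).eval (Real.sin φ) =
      (-1) ^ n * Real.sin ((2 * n + 1) * φ) := by
  rw [← Real.cos_pi_div_two_sub, Polynomial.Chebyshev.T_real_cos]
  push_cast
  rw [show (2 * (n : ℝ) + 1) * (Real.pi / 2 - φ) =
    (Real.pi / 2 - (2 * n + 1) * φ) + n * Real.pi by ring, Real.cos_add_nat_mul_pi,
    Real.cos_pi_div_two_sub]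

/-! ### Interpolation of even functions -/

open Polynomial in
/-- Interpolation of a function which agrees at the nodes with a polynomial in `x²`. -/
theorem sum_mul_eval_basis_chebyshevNode (n : ℕ) (q : ℝ[X]) (hq : q.natDegree ≤ n) (f : ℝ → ℝ)
    (hf : ∀ j ∈ Finset.Icc 1 (2 * n + 1),
      f (chebyshevNode n j) = q.eval (chebyshevNode n j ^ 2)) (y : ℝ) :
    ∑ j ∈ Finset.Icc 1 (2 * n + 1), f (chebyshevNode n j) *
      (Lagrange.basis (Finset.Icc 1 (2 * n + 1)) (chebyshevNode n) j).eval y = q.eval (y ^ 2) := by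
  have hdeg : (q.comp (X ^ 2)).degree < (Finset.Icc 1 (2 * n + 1)).card := by
    refine degree_le_natDegree.trans_lt ?_
    rw [natDegree_comp, natDegree_X_pow, Nat.card_Icc]
    exact_mod_cast (by omega : q.natDegree * 2 < 2 * n + 1 + 1 - 1)
  have h := Lagrange.eq_interpolate_of_eval_eq (fun j => f (chebyshevNode n j))
    (chebyshevNode_injOn n) hdeg (fun j hj => by simp [hf j hj])
  have h' := congrArg (eval y) h
  rw [Lagrange.interpolate_apply, eval_finsetSum] at h'
  simpa using h'.symm

open Polynomial in
/-- The interpolation error for `x ↦ x^{2m+2} / (x² + t²)`. -/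
theorem interp_error_rational (n m : ℕ) (hm : m ≤ n) {t : ℝ} (ht : 0 < t) (φ : ℝ) :
    Real.sin φ ^ (2 * m + 2) / (Real.sin φ ^ 2 + t ^ 2) -
      ∑ j ∈ Finset.Icc 1 (2 * n + 1),
        chebyshevNode n j ^ (2 * m + 2) / (chebyshevNode n j ^ 2 + t ^ 2) *
        (Lagrange.basis (Finset.Icc 1 (2 * n + 1)) (chebyshevNode n) j).eval (Real.sin φ) =
      (-1) ^ m * (t ^ (2 * m + 1) / Real.sinh ((2 * n + 1) * Real.arsinh t) *
        (Real.sin φ * Real.sin ((2 * n + 1) * φ) / (Real.sin φ ^ 2 + t ^ 2))) := by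
  set W := oddChebyshevSq n with hW
  have hs : 0 < Real.sinh ((2 * n + 1) * Real.arsinh t) := by
    rw [Real.sinh_pos_iff]
    have := Real.arsinh_pos_iff.2 ht
    positivity
  have hW0 : W.eval (-t ^ 2) =
      (-1) ^ (n + 1) * (t * Real.sinh ((2 * n + 1) * Real.arsinh t)) := by
    have := eval_neg_sinh_sq_oddChebyshevSq n (Real.arsinh t)
    rwa [Real.sinh_arsinh] at this
  have hW0' : W.eval (-t ^ 2) ≠ 0 := by
    rw [hW0]
    have : (-1 : ℝ) ^ (n + 1) ≠ 0 := by simp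
    positivity
  -- This c makes V vanish at -t², so X + t² divides V. As W vanishes at the squared nodes, the
  -- quotient q(x²) is the interpolant.
  set c := (-t ^ 2) ^ (m + 1) / W.eval (-t ^ 2) with hc
  set V : ℝ[X] := X ^ (m + 1) - C c * W with hV
  have hV0 : V.eval (-t ^ 2) = 0 := by
    simp [hV, hc, hW0']
  have hVdeg : V.natDegree ≤ n + 1 := by
    refine (natDegree_sub_le _ _).trans (max_le ?_ ?_)
    · rw [natDegree_X_pow]; omega
    · exact (natDegree_C_mul_le _ _).trans (natDegree_oddChebyshevSq_le n)
  set q := V /ₘ (X - C (-t ^ 2)) with hq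
  have hqdeg : q.natDegree ≤ n := by
    rw [hq, natDegree_divByMonic _ (monic_X_sub_C _), natDegree_X_sub_C]; omega
  have hVq (x : ℝ) : V.eval (x ^ 2) = (x ^ 2 + t ^ 2) * q.eval (x ^ 2) := by
    have h := modByMonic_add_div V (X - C (-t ^ 2))
    rw [modByMonic_X_sub_C_eq_C_eval, hV0] at h
    rw [← h]
    simp [hq]
  have hpos (x : ℝ) : x ^ 2 + t ^ 2 ≠ 0 := by positivity
  have hqe (x : ℝ) : q.eval (x ^ 2) =
      x ^ (2 * m + 2) / (x ^ 2 + t ^ 2) - c * W.eval (x ^ 2) / (x ^ 2 + t ^ 2) := by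
    rw [← sub_div, eq_div_iff (hpos x), mul_comm, ← hVq]
    simp [hV]; ring
  rw [sum_mul_eval_basis_chebyshevNode n q hqdeg
    (fun x => x ^ (2 * m + 2) / (x ^ 2 + t ^ 2)) _ (Real.sin φ), hqe, sub_sub_cancel,
    hW, eval_sq_oddChebyshevSq, eval_chebyshevT_odd_sin, hc, hW0]
  · have h3 := hpos (Real.sin φ)
    rw [neg_pow (t ^ 2), ← pow_mul]
    field_simp
    ring_nf
  · intro j hj
    have hr := chebyshevNode_isRoot n j
    rw [IsRoot] at hr
    rw [hqe, hW, eval_sq_oddChebyshevSq, hr]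
    simp

open Polynomial in
theorem eval_interpPoly (α : ℝ) (n : ℕ) (y : ℝ) :
    (interpPoly α n).eval y = ∑ j ∈ Finset.Icc 1 (2 * n + 1), |chebyshevNode n j| ^ α *
      (Lagrange.basis (Finset.Icc 1 (2 * n + 1)) (chebyshevNode n) j).eval y := by
  rw [interpPoly, Lagrange.interpolate_apply, eval_finsetSum]
  simp

-- Covers even integer exponents, where the integral representation is not available.
open Polynomial in
theorem eval_interpPoly_even (m n : ℕ) (hm : m ≤ n) (y : ℝ) :
    (interpPoly (2 * m : ℕ) n).eval y = |y| ^ ((2 * m : ℕ) : ℝ) := by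
  have habs (x : ℝ) : |x| ^ ((2 * m : ℕ) : ℝ) = (X ^ m : ℝ[X]).eval (x ^ 2) := by
    rw [Real.rpow_natCast, pow_mul, sq_abs]; simp
  rw [eval_interpPoly, habs]
  exact sum_mul_eval_basis_chebyshevNode n (X ^ m) (by simpa using hm)
    (fun x => |x| ^ ((2 * m : ℕ) : ℝ)) (fun j _ => habs _) y

/-! ### Integral representation of |x|^α -/

open MeasureTheory Set in
/-- The Beta integral in trigonometric form. -/
theorem integral_Ioo_rpow_mul_one_sub_rpow {s : ℝ} (h0 : 0 < s) (h1 : s < 1) :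
    ∫ x in Ioo (0 : ℝ) 1, x ^ (s - 1) * (1 - x) ^ (-s) = Real.pi / Real.sin (Real.pi * s) := by
  have hB := ProbabilityTheory.beta_eq_betaIntegralReal s (1 - s) h0 (by linarith)
  rw [ProbabilityTheory.beta, Real.Gamma_mul_Gamma_one_sub, add_sub_cancel, Real.Gamma_one,
    div_one] at hB
  have hI : Complex.betaIntegral s ((1 - s : ℝ) : ℂ) =
      ((∫ x in Ioo (0 : ℝ) 1, x ^ (s - 1) * (1 - x) ^ (-s) : ℝ) : ℂ) := by
    rw [Complex.betaIntegral, intervalIntegral.integral_of_le zero_le_one,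
      integral_Ioc_eq_integral_Ioo, ← integral_complex_ofReal]
    refine setIntegral_congr_fun measurableSet_Ioo fun x hx => ?_
    rw [Complex.ofReal_mul, Complex.ofReal_cpow hx.1.le, Complex.ofReal_cpow (by linarith [hx.2])]
    push_cast
    congr 2
    ring
  rw [hI, Complex.ofReal_re] at hB
  exact hB.symm

open MeasureTheory Set in
theorem image_sq_div_Ioi {a : ℝ} (ha : 0 < a) :
    (fun t : ℝ => t ^ 2 / (t ^ 2 + a ^ 2)) '' Ioi 0 = Ioo 0 1 := by
  ext x
  constructor
  · rintro ⟨t, ht, rfl⟩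
    have ht : 0 < t := ht
    refine ⟨by positivity, ?_⟩
    simp only
    rw [div_lt_one (by positivity)]
    have : 0 < a ^ 2 := by positivity
    linarith
  · rintro ⟨h0, h1⟩
    have h1' : 0 < 1 - x := by linarith
    refine ⟨√(a ^ 2 * x / (1 - x)), Real.sqrt_pos.2 (by positivity), ?_⟩
    simp only
    rw [Real.sq_sqrt (by positivity)]
    field_simp
    ring

open MeasureTheory Set in
/-- The Mellin transform of `t ↦ a² / (a² + t²)`. -/
theorem integral_rpow_mul_div_sq_add_sq {β a : ℝ} (h0 : 0 < β) (h2 : β < 2) (ha : 0 < a) :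
    ∫ t in Ioi (0 : ℝ), t ^ (β - 1) * (a ^ 2 / (a ^ 2 + t ^ 2)) =
      a ^ β * (Real.pi / (2 * Real.sin (Real.pi * β / 2))) := by
  -- The substitution u = t² / (t² + a²), 1 - u = a² / (t² + a²), leads to the Beta integral with s
  -- = β/2.
  have hd : ∀ t ∈ Ioi (0 : ℝ), HasDerivWithinAt (fun t : ℝ => t ^ 2 / (t ^ 2 + a ^ 2))
      (2 * t * a ^ 2 / (t ^ 2 + a ^ 2) ^ 2) (Ioi 0) t := by
    intro t ht
    have h := ((hasDerivAt_pow 2 t).div ((hasDerivAt_pow 2 t).add_const (a ^ 2))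
      (by positivity : t ^ 2 + a ^ 2 ≠ 0)).hasDerivWithinAt (s := Ioi 0)
    convert! h using 1
    simp
    ring
  have hinj : InjOn (fun t : ℝ => t ^ 2 / (t ^ 2 + a ^ 2)) (Ioi 0) := by
    intro s hs t ht hst
    have hs : 0 < s := hs
    have ht : 0 < t := ht
    simp only at hst
    rw [div_eq_div_iff (by positivity) (by positivity)] at hst
    have h : s ^ 2 = t ^ 2 := by
      have : a ^ 2 * (s ^ 2 - t ^ 2) = 0 := by linarith
      rcases mul_eq_zero.1 this with h | h
      · exact absurd h (by positivity)
      · linarith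
    exact (pow_left_inj₀ hs.le ht.le two_ne_zero).1 h
  have h := integral_image_eq_integral_abs_deriv_smul measurableSet_Ioi hd hinj
    (fun x => x ^ (β / 2 - 1) * (1 - x) ^ (-(β / 2)))
  rw [image_sq_div_Ioi ha, integral_Ioo_rpow_mul_one_sub_rpow (by linarith) (by linarith)] at h
  have hcongr : ∀ t ∈ Ioi (0 : ℝ), t ^ (β - 1) * (a ^ 2 / (a ^ 2 + t ^ 2)) =
      a ^ β / 2 * (|2 * t * a ^ 2 / (t ^ 2 + a ^ 2) ^ 2| •
        ((t ^ 2 / (t ^ 2 + a ^ 2)) ^ (β / 2 - 1) *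
          (1 - t ^ 2 / (t ^ 2 + a ^ 2)) ^ (-(β / 2)))) := by
    intro t ht
    have ht : 0 < t := ht
    have hD : 0 < t ^ 2 + a ^ 2 := by positivity
    have e1 : 1 - t ^ 2 / (t ^ 2 + a ^ 2) = a ^ 2 / (t ^ 2 + a ^ 2) := by field_simp; ring
    have e2 : (t ^ 2) ^ (β / 2 - 1) = t ^ (β - 1) / t := by
      rw [← Real.rpow_natCast, ← Real.rpow_mul ht.le, ← Real.rpow_sub_one ht.ne']
      congr 1; push_cast; ring
    have e3 : (a ^ 2) ^ (-(β / 2)) = (a ^ β)⁻¹ := by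
      rw [← Real.rpow_natCast, ← Real.rpow_mul ha.le, ← Real.rpow_neg ha.le]
      congr 1; push_cast; ring
    have e4 : (t ^ 2 + a ^ 2) ^ (β / 2 - 1) * (t ^ 2 + a ^ 2) ^ (-(β / 2)) =
        (t ^ 2 + a ^ 2)⁻¹ := by
      rw [← Real.rpow_add hD, ← Real.rpow_neg_one]; congr 1; ring
    have e5 : (t ^ 2 + a ^ 2) ^ (β / 2 - 1) ≠ 0 := (Real.rpow_pos_of_pos hD _).ne'
    have e6 : (t ^ 2 + a ^ 2) ^ (-(β / 2)) ≠ 0 := (Real.rpow_pos_of_pos hD _).ne'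
    have e7 : a ^ β ≠ 0 := (Real.rpow_pos_of_pos ha _).ne'
    rw [e1, Real.div_rpow (by positivity) hD.le, Real.div_rpow (by positivity) hD.le, e2, e3,
      abs_of_pos (by positivity), smul_eq_mul, div_mul_div_comm (t ^ (β - 1) / t), e4]
    field_simp
    ring
  rw [setIntegral_congr_fun measurableSet_Ioi hcongr, integral_const_mul, ← h,
    show Real.pi * (β / 2) = Real.pi * β / 2 by ring]
  field_simp

theorem sin_pi_mul_half_pos {β : ℝ} (h0 : 0 < β) (h2 : β < 2) :
    0 < Real.sin (Real.pi * β / 2) :=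
  Real.sin_pos_of_pos_of_lt_pi (by positivity) (by nlinarith [Real.pi_pos])

open MeasureTheory Set in
theorem integrableOn_rpow_mul_div_sq_add_sq {β : ℝ} (h0 : 0 < β) (h2 : β < 2) (a : ℝ) :
    IntegrableOn (fun t : ℝ => t ^ (β - 1) * (a ^ 2 / (a ^ 2 + t ^ 2))) (Ioi 0) := by
  rcases eq_or_ne a 0 with rfl | ha
  · simp
  -- A non-integrable function has integral 0 by convention, whereas the formula, proved without
  -- assuming integrability, gives a positive value.
  by_contra h
  have h1 := integral_undef h
  rw [← sq_abs, integral_rpow_mul_div_sq_add_sq h0 h2 (abs_pos.2 ha)] at h1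
  have := sin_pi_mul_half_pos h0 h2
  have : 0 < |a| ^ β := Real.rpow_pos_of_pos (abs_pos.2 ha) _
  have := Real.pi_pos
  exact absurd h1 (by positivity)

open MeasureTheory Set in
/-- `|x|^{2m+β}` as a superposition of the functions `x^{2m+2} / (x² + t²)`. -/
theorem abs_rpow_eq_integral {β : ℝ} (h0 : 0 < β) (h2 : β < 2) (m : ℕ) (x : ℝ) :
    |x| ^ (2 * m + β) = 2 / Real.pi * Real.sin (Real.pi * β / 2) *
      ∫ t in Ioi (0 : ℝ), t ^ (β - 1) * (x ^ (2 * m + 2) / (x ^ 2 + t ^ 2)) := by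
  rcases eq_or_ne x 0 with rfl | hx
  · rw [abs_zero, Real.zero_rpow (by positivity)]
    simp
  have hs := (sin_pi_mul_half_pos h0 h2).ne'
  have hx' := abs_pos.2 hx
  have e (t : ℝ) : t ^ (β - 1) * (x ^ (2 * m + 2) / (x ^ 2 + t ^ 2)) =
      x ^ (2 * m) * (t ^ (β - 1) * (|x| ^ 2 / (|x| ^ 2 + t ^ 2))) := by
    rw [sq_abs, pow_add]; ring
  simp_rw [e]
  rw [integral_const_mul, integral_rpow_mul_div_sq_add_sq h0 h2 hx', Real.rpow_add hx']
  have : |x| ^ (2 * (m : ℝ)) = x ^ (2 * m) := by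
    rw [show 2 * (m : ℝ) = ((2 * m : ℕ) : ℝ) by push_cast; ring, Real.rpow_natCast, pow_mul,
      sq_abs, pow_mul]
  rw [this]
  have := Real.pi_pos.ne'
  field_simp

/-! ### Exact interpolation error -/

open MeasureTheory Set in
/-- The exact interpolation error of `|x|^{2m+β}`. -/
theorem interpPoly_error {β : ℝ} (h0 : 0 < β) (h2 : β < 2) {n m : ℕ} (hm : m ≤ n) (φ : ℝ) :
    |Real.sin φ| ^ (2 * m + β) - (interpPoly (2 * m + β) n).eval (Real.sin φ) =
      2 / Real.pi * Real.sin (Real.pi * (2 * m + β) / 2) *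
      ∫ t in Ioi (0 : ℝ), t ^ (2 * m + β) / Real.sinh ((2 * n + 1) * Real.arsinh t) *
        (Real.sin φ * Real.sin ((2 * n + 1) * φ) / (Real.sin φ ^ 2 + t ^ 2)) := by
  have hint (x : ℝ) : IntegrableOn
      (fun t : ℝ => t ^ (β - 1) * (x ^ (2 * m + 2) / (x ^ 2 + t ^ 2))) (Ioi 0) := by
    refine ((integrableOn_rpow_mul_div_sq_add_sq h0 h2 x).const_mul (x ^ (2 * m))).congr ?_
    refine Filter.Eventually.of_forall fun t => ?_
    simp only
    rw [pow_add]; ring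
  -- This sign matches the (-1)^m in the error of each rational function.
  have hsin : Real.sin (Real.pi * (2 * m + β) / 2) = (-1) ^ m * Real.sin (Real.pi * β / 2) := by
    rw [show Real.pi * (2 * m + β) / 2 = Real.pi * β / 2 + m * Real.pi by ring,
      Real.sin_add_nat_mul_pi]
  rw [eval_interpPoly]
  simp_rw [abs_rpow_eq_integral h0 h2]
  simp_rw [mul_assoc (2 / Real.pi * Real.sin (Real.pi * β / 2)), ← integral_mul_const]
  rw [← Finset.mul_sum, ← integral_finsetSum _ (fun j _ => (hint _).mul_const _), ← mul_sub,
    ← integral_sub (hint _) (integrable_finsetSum _ fun j _ => (hint _).mul_const _), hsin,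
    show 2 / Real.pi * ((-1) ^ m * Real.sin (Real.pi * β / 2)) =
      2 / Real.pi * Real.sin (Real.pi * β / 2) * (-1) ^ m by ring, mul_assoc _ ((-1 : ℝ) ^ m),
    ← integral_const_mul ((-1 : ℝ) ^ m)]
  refine congrArg _ (setIntegral_congr_fun measurableSet_Ioi fun t ht => ?_)
  have ht : 0 < t := ht
  simp only [mul_assoc]
  rw [← Finset.mul_sum, ← mul_sub, interp_error_rational n m hm ht]
  have e : t ^ (2 * m + β) = t ^ (β - 1) * t ^ (2 * m + 1) := by
    rw [← Real.rpow_natCast, ← Real.rpow_add ht]; congr 1; push_cast; ring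
  rw [e]
  ring

/-! ### Lower bounds for sinh(c arsinh(s/c)) and an integrable majorant -/

theorem sinh_mul_le_mul_sinh {l θ : ℝ} (hl0 : 0 ≤ l) (hl1 : l ≤ 1) (hθ : 0 ≤ θ) :
    Real.sinh (l * θ) ≤ l * Real.sinh θ := by
  have hd (x : ℝ) : HasDerivAt (fun x => l * Real.sinh x - Real.sinh (l * x))
      (l * (Real.cosh x - Real.cosh (l * x))) x := by
    have h1 := (Real.hasDerivAt_sinh x).const_mul l
    have h2 := (Real.hasDerivAt_sinh (l * x)).comp x ((hasDerivAt_id x).const_mul l)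
    convert! h1.sub h2 using 1
    ring
  have hmono : MonotoneOn (fun x => l * Real.sinh x - Real.sinh (l * x)) (Set.Ici 0) := by
    refine monotoneOn_of_deriv_nonneg (convex_Ici 0)
      (fun x _ => (hd x).continuousAt.continuousWithinAt)
      (fun x _ => (hd x).differentiableAt.differentiableWithinAt) fun x hx => ?_
    rw [interior_Ici] at hx
    have hx : 0 < x := hx
    rw [(hd x).deriv]
    refine mul_nonneg hl0 (sub_nonneg.2 (Real.cosh_le_cosh.2 ?_))
    rw [abs_of_nonneg (by positivity), abs_of_pos hx]
    nlinarith
  have := hmono (Set.self_mem_Ici) (Set.mem_Ici.2 hθ) hθ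
  simp only [mul_zero, Real.sinh_zero, sub_zero] at this
  linarith

/-- Monotonicity of c ↦ c arsinh(s/c): apply the previous inequality with l = k/c and θ =
arsinh(s/k). It lets one fixed k dominate all large n. -/
theorem mul_arsinh_div_le {k c s : ℝ} (hk : 0 < k) (hkc : k ≤ c) (hs : 0 ≤ s) :
    k * Real.arsinh (s / k) ≤ c * Real.arsinh (s / c) := by
  have hc : 0 < c := hk.trans_le hkc
  have h := sinh_mul_le_mul_sinh (div_nonneg hk.le hc.le) ((div_le_one hc).2 hkc)
    (Real.arsinh_nonneg_iff.2 (div_nonneg hs hk.le))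
  rw [Real.sinh_arsinh, div_mul_div_comm, mul_comm c k, mul_div_mul_left _ _ hk.ne'] at h
  have h2 := Real.arsinh_le_arsinh.2 h
  rw [Real.arsinh_sinh, div_mul_eq_mul_div, div_le_iff₀ hc] at h2
  linarith

theorem sinh_pow_le_sinh_mul (k : ℕ) {θ : ℝ} (hθ : 0 ≤ θ) :
    Real.sinh θ ^ (k + 1) ≤ Real.sinh ((k + 1) * θ) := by
  induction k with
  | zero => simp
  | succ k ih =>
    have h0 : 0 ≤ Real.sinh θ := Real.sinh_nonneg_iff.2 hθ
    have h1 : 0 ≤ Real.sinh ((k + 1) * θ) := Real.sinh_nonneg_iff.2 (by positivity)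
    push_cast
    rw [pow_succ, show ((k : ℝ) + 1 + 1) * θ = (k + 1) * θ + θ by ring, Real.sinh_add]
    have h2 : Real.sinh θ ^ (k + 1) * Real.sinh θ ≤ Real.sinh ((k + 1) * θ) * Real.cosh θ :=
      mul_le_mul ih (Real.sinh_lt_cosh θ).le h0 h1
    have h3 : 0 ≤ Real.cosh ((k + 1) * θ) * Real.sinh θ :=
      mul_nonneg (Real.cosh_pos _).le h0
    linarith

theorem le_sinh_mul_arsinh_div {c s : ℝ} (hc : 1 ≤ c) (hs : 0 ≤ s) :
    s ≤ Real.sinh (c * Real.arsinh (s / c)) := by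
  have h := mul_arsinh_div_le one_pos hc hs
  rw [one_mul, div_one, ← Real.sinh_le_sinh, Real.sinh_arsinh] at h
  exact h

-- Near 0 the denominator is at least s, leaving s^(α-1). At infinity it is at least (s/k)^k, and α
-- - k < -1.
open MeasureTheory Set in
theorem integrableOn_rpow_div_sinh_mul_arsinh {α : ℝ} (hα : 0 < α) {k : ℕ}
    (hk : α + 1 < k) :
    IntegrableOn (fun s : ℝ => s ^ α / Real.sinh (k * Real.arsinh (s / k))) (Ioi 0) := by
  have hk1 : (1 : ℝ) ≤ k := by linarith
  have hk0 : (0 : ℝ) < k := by linarith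
  have hmeas : Measurable fun s : ℝ => s ^ α / Real.sinh (k * Real.arsinh (s / k)) :=
    (measurable_id.pow_const α).div
      (Real.measurable_sinh.comp
        (measurable_const.mul (Real.continuous_arsinh.measurable.comp (measurable_id.div_const _))))
  have hB (s : ℝ) (hs : 0 < s) : s ≤ Real.sinh (k * Real.arsinh (s / k)) :=
    le_sinh_mul_arsinh_div hk1 hs.le
  rw [← Ioc_union_Ioi_eq_Ioi zero_le_one]
  refine IntegrableOn.union ?_ ?_
  · have h0 : IntegrableOn (fun s : ℝ => s ^ (α - 1)) (Ioc 0 1) :=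
      (intervalIntegrable_iff_integrableOn_Ioc_of_le zero_le_one).1
        (intervalIntegral.intervalIntegrable_rpow' (by linarith))
    refine Integrable.mono' h0 hmeas.aestronglyMeasurable ?_
    filter_upwards [ae_restrict_mem measurableSet_Ioc] with s hs
    have hs0 : 0 < s := hs.1
    have hb := hB s hs0
    rw [Real.norm_of_nonneg (div_nonneg (by positivity) (hs0.le.trans hb)),
      Real.rpow_sub_one hs0.ne']
    exact div_le_div_of_nonneg_left (by positivity) hs0 hb
  · have h0 : IntegrableOn (fun s : ℝ => s ^ (α - k) * (k : ℝ) ^ k) (Ioi 1) :=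
      (integrableOn_Ioi_rpow_of_lt (by linarith) one_pos).mul_const _
    refine Integrable.mono' h0 hmeas.aestronglyMeasurable ?_
    filter_upwards [ae_restrict_mem measurableSet_Ioi] with s hs
    have hs1 : 1 < s := hs
    have hs0 : 0 < s := by linarith
    have hb : (s / k) ^ k ≤ Real.sinh (k * Real.arsinh (s / k)) := by
      obtain ⟨j, rfl⟩ : ∃ j, k = j + 1 := Nat.exists_eq_succ_of_ne_zero (by
        rintro rfl; simp at hk0)
      have := sinh_pow_le_sinh_mul j
        (Real.arsinh_nonneg_iff.2 (div_nonneg hs0.le hk0.le))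
      rw [Real.sinh_arsinh] at this
      push_cast at this ⊢
      exact this
    rw [Real.norm_of_nonneg (div_nonneg (by positivity) (hs0.le.trans (hB s hs0))),
      Real.rpow_sub hs0, Real.rpow_natCast]
    refine (div_le_div_of_nonneg_left (by positivity) (by positivity) hb).trans_eq ?_
    rw [div_pow]
    field_simp

theorem rpow_div_sinh_le {α s : ℝ} (hs : 0 < s) {k n : ℕ} (hk : 1 ≤ k) (hkn : k ≤ 2 * n) :
    s ^ α / Real.sinh ((2 * n + 1) * Real.arsinh (s / (2 * n))) ≤
      s ^ α / Real.sinh (k * Real.arsinh (s / k)) := by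
  have hk0 : (0 : ℝ) < k := by exact_mod_cast hk
  have hkn' : (k : ℝ) ≤ 2 * n := by exact_mod_cast hkn
  have h1 := mul_arsinh_div_le hk0 hkn' hs.le
  have h2 : 0 < Real.arsinh (s / (2 * n)) := Real.arsinh_pos_iff.2 (div_pos hs (by linarith))
  have h3 : 0 < Real.arsinh (s / k) := Real.arsinh_pos_iff.2 (div_pos hs hk0)
  refine div_le_div_of_nonneg_left (by positivity) (Real.sinh_pos_iff.2 (by positivity))
    (Real.sinh_le_sinh.2 ?_)
  linarith

/-! ### Limits under the rescaling -/

-- Up to the extra term g(s/2n) → 0, this is the difference quotient at 0 of u ↦ g(su) with step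
-- 1/(2n).
open Filter Topology in
theorem tendsto_mul_comp_div {g : ℝ → ℝ} (hg : HasDerivAt g 1 0) (hg0 : g 0 = 0) (s : ℝ) :
    Tendsto (fun n : ℕ => (2 * (n : ℝ) + 1) * g (s / (2 * n))) atTop (𝓝 s) := by
  have hd : HasDerivAt (fun u : ℝ => g (s * u)) s 0 := by
    have h := HasDerivAt.comp (0 : ℝ) (h₂ := g) (h := fun u => s * u) (by simpa using hg)
      ((hasDerivAt_id (0 : ℝ)).const_mul s)
    simpa [Function.comp_def] using h
  have hinv : Tendsto (fun n : ℕ => (2 * (n : ℝ))⁻¹) atTop (𝓝[≠] 0) := by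
    refine tendsto_nhdsWithin_iff.2 ⟨?_, ?_⟩
    · exact tendsto_inv_atTop_zero.comp
        (tendsto_natCast_atTop_atTop.const_mul_atTop two_pos)
    · filter_upwards [eventually_gt_atTop 0] with n hn
      have : (n : ℝ) ≠ 0 := by exact_mod_cast hn.ne'
      simpa using this
  have h1 := hd.tendsto_slope_zero.comp hinv
  have h2 := (tendsto_nhdsWithin_iff.1 hinv).1
  have h3 := (hd.continuousAt.tendsto.comp h2)
  have h4 := h1.add h3
  simp only [mul_zero, hg0, add_zero] at h4
  refine h4.congr fun n => ?_
  simp [div_eq_mul_inv]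
  ring

-- The bound is ε x rather than ε: the extra x is needed against x / (x² + s²) when x and s are both
-- small.
open Filter Topology in
theorem eventually_abs_sin_arcsin_sub_le (R : ℝ) {ε : ℝ} (hε : 0 < ε) :
    ∀ᶠ n : ℕ in atTop, ∀ x ∈ Set.Icc 0 R,
      |Real.sin ((2 * n + 1) * Real.arcsin (x / (2 * n))) - Real.sin x| ≤ ε * x := by
  have hd : HasDerivAt Real.arcsin 1 0 := by
    simpa using Real.hasDerivAt_arcsin (x := 0) (by norm_num) (by norm_num)
  have ho := hd.isLittleO.def (show 0 < ε / 4 by positivity)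
  obtain ⟨δ, hδ, hball⟩ := Metric.eventually_nhds_iff.1 ho
  -- n > R/δ puts x/(2n) where arcsin is ε/4-close to linear; n > 1/ε absorbs the leftover y caused
  -- by 2n + 1 in place of 2n.
  filter_upwards [eventually_gt_atTop ⌈R / δ⌉₊, eventually_gt_atTop ⌈1 / ε⌉₊,
    eventually_ge_atTop 1] with n hnR hnε hn1 x hx
  have hn1' : (1 : ℝ) ≤ n := by exact_mod_cast hn1
  have hnR' : R / δ < n := Nat.lt_of_ceil_lt hnR
  have hnε' : 1 / ε < n := Nat.lt_of_ceil_lt hnε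
  rw [div_lt_iff₀ hδ] at hnR'
  rw [div_lt_iff₀ hε] at hnε'
  set y := x / (2 * n) with hy
  have hxy : x = 2 * n * y := by rw [hy]; field_simp
  have hy0 : 0 ≤ y := div_nonneg hx.1 (by positivity)
  have hyδ : y < δ := by
    rw [hy, div_lt_iff₀ (by positivity)]
    nlinarith [hx.2]
  have hb := hball (y := y) (by simpa [abs_of_nonneg hy0] using hyδ)
  simp only [Real.arcsin_zero, sub_zero, smul_eq_mul, mul_one, Real.norm_eq_abs,
    abs_of_nonneg hy0] at hb
  have hb := abs_le.1 hb
  refine (Real.abs_sin_sub_sin_le _ _).trans ?_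
  have e : (2 * (n : ℝ) + 1) * Real.arcsin y - x =
      (2 * n + 1) * (Real.arcsin y - y) + y := by rw [hxy]; ring
  rw [e, hxy, abs_le]
  constructor <;> nlinarith [mul_nonneg hε.le hy0, mul_nonneg (mul_nonneg hε.le hy0) (by linarith : (0 : ℝ) ≤ n - 1)]

open MeasureTheory Set in
/-- The exact interpolation error, rescaled by `2n`. -/
theorem scaled_interpPoly_error {α : ℝ} (hα : 0 < α) {n : ℕ} (hn : 1 ≤ n) (hαn : α ≤ n)
    {x : ℝ} (hx0 : 0 ≤ x) (hxn : x ≤ 2 * n) :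
    |x| ^ α - (2 * (n : ℝ)) ^ α * (interpPoly α n).eval (x / (2 * n)) =
      2 / Real.pi * Real.sin (Real.pi * α / 2) * ∫ s in Ioi (0 : ℝ),
        s ^ α / Real.sinh ((2 * n + 1) * Real.arsinh (s / (2 * n))) *
          (x * Real.sin ((2 * n + 1) * Real.arcsin (x / (2 * n))) / (x ^ 2 + s ^ 2)) := by
  have hn0 : (0 : ℝ) < 2 * n := by
    have : (1 : ℝ) ≤ n := by exact_mod_cast hn
    linarith
  have hscale : |x| ^ α = (2 * (n : ℝ)) ^ α * |x / (2 * n)| ^ α := by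
    rw [abs_div, abs_of_pos hn0, Real.div_rpow (abs_nonneg _) hn0.le, mul_div_cancel₀]
    exact (Real.rpow_pos_of_pos hn0 _).ne'
  -- If β = 0, both sides vanish.
  obtain ⟨m, β, hβ0, hβ2, rfl⟩ : ∃ (m : ℕ) (β : ℝ), 0 ≤ β ∧ β < 2 ∧ 2 * m + β = α := by
    refine ⟨⌊α / 2⌋₊, α - 2 * ⌊α / 2⌋₊, ?_, ?_, by ring⟩
    · linarith [Nat.floor_le (by positivity : 0 ≤ α / 2)]
    · linarith [Nat.lt_floor_add_one (α / 2)]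
  have hmn : m ≤ n := by
    have h0 : (0 : ℝ) ≤ m := m.cast_nonneg
    exact_mod_cast (by linarith : (m : ℝ) ≤ n)
  rcases hβ0.eq_or_lt with rfl | hβ0
  · have hsin : Real.sin (Real.pi * (2 * m + 0) / 2) = 0 := by
      rw [show Real.pi * (2 * (m : ℝ) + 0) / 2 = m * Real.pi by ring, Real.sin_nat_mul_pi]
    have he := eval_interpPoly_even m n hmn (x / (2 * n))
    push_cast at he
    rw [hscale, hsin, add_zero, he]
    ring
  · have hy0 : 0 ≤ x / (2 * n) := by positivity
    have hy1 : x / (2 * n) ≤ 1 := (div_le_one hn0).2 hxn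
    have h := interpPoly_error hβ0 hβ2 hmn (Real.arcsin (x / (2 * n)))
    rw [Real.sin_arcsin (by linarith) hy1] at h
    rw [hscale, ← mul_sub, h, mul_left_comm]
    congr 1
    set α := 2 * (m : ℝ) + β
    set S := Real.sin ((2 * n + 1) * Real.arcsin (x / (2 * n)))
    have hc := integral_comp_mul_left_Ioi (fun s : ℝ =>
      s ^ α / Real.sinh ((2 * n + 1) * Real.arsinh (s / (2 * n))) * (x * S / (x ^ 2 + s ^ 2)))
      0 hn0
    rw [mul_zero, smul_eq_mul, eq_inv_mul_iff_mul_eq₀ hn0.ne'] at hc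
    rw [← hc, ← integral_const_mul, ← integral_const_mul]
    refine setIntegral_congr_fun measurableSet_Ioi fun t ht => ?_
    have ht : 0 < t := ht
    rw [mul_div_cancel_left₀ _ hn0.ne', Real.mul_rpow hn0.le ht.le,
      show (x / (2 * n)) ^ 2 + t ^ 2 = (x ^ 2 + (2 * n * t) ^ 2) / (2 * n) ^ 2 by field_simp]
    have : 0 < x ^ 2 + (2 * n * t) ^ 2 := by positivity
    field_simp

theorem abs_mul_div_sq_add_sq_le {x c s S : ℝ} (hc : 0 ≤ c) (hx : 0 ≤ x) (hs : 0 < s)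
    (hS : |S| ≤ c * x) : |x * S / (x ^ 2 + s ^ 2)| ≤ c := by
  have hD : 0 < x ^ 2 + s ^ 2 := by positivity
  rw [abs_div, abs_of_pos hD, div_le_iff₀ hD, abs_mul, abs_of_nonneg hx]
  nlinarith [mul_le_mul_of_nonneg_left hS hx, mul_nonneg hc (sq_nonneg s)]

/-! ### L¹ convergence of the kernels -/

/-- The kernel of the rescaled interpolation error. -/
noncomputable def interpKernel (α : ℝ) (n : ℕ) (s : ℝ) : ℝ :=
  s ^ α / Real.sinh ((2 * n + 1) * Real.arsinh (s / (2 * n)))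

theorem measurable_interpKernel (α : ℝ) (n : ℕ) : Measurable (interpKernel α n) :=
  (measurable_id.pow_const α).div
    (Real.measurable_sinh.comp
      (measurable_const.mul (Real.continuous_arsinh.measurable.comp (measurable_id.div_const _))))

theorem interpKernel_nonneg (α : ℝ) (n : ℕ) {s : ℝ} (hs : 0 < s) : 0 ≤ interpKernel α n s := by
  have : 0 ≤ Real.arsinh (s / (2 * n)) := Real.arsinh_nonneg_iff.2 (by positivity)
  exact div_nonneg (by positivity) (Real.sinh_nonneg_iff.2 (by positivity))

open Filter Topology in
theorem tendsto_interpKernel (α : ℝ) {s : ℝ} (hs : 0 < s) :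
    Tendsto (fun n => interpKernel α n s) atTop (𝓝 (s ^ α / Real.sinh s)) := by
  have hd : HasDerivAt Real.arsinh 1 0 := by simpa using Real.hasDerivAt_arsinh 0
  exact tendsto_const_nhds.div
    ((Real.continuous_sinh.tendsto s).comp (tendsto_mul_comp_div hd Real.arsinh_zero s))
    (Real.sinh_pos_iff.2 hs).ne'

open MeasureTheory Set Filter Topology in
theorem exists_integrable_bound_interpKernel {α : ℝ} (hα : 0 < α) :
    ∃ G : ℝ → ℝ, IntegrableOn G (Ioi 0) ∧
      ∀ᶠ n in atTop, ∀ s ∈ Ioi (0 : ℝ), interpKernel α n s ≤ G s := by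
  obtain ⟨k, hk⟩ := exists_nat_gt (α + 1)
  have hk1 : 1 ≤ k := by
    have : (1 : ℝ) < k := by linarith
    exact_mod_cast this.le
  refine ⟨_, integrableOn_rpow_div_sinh_mul_arsinh hα hk, ?_⟩
  filter_upwards [eventually_ge_atTop k] with n hn s hs
  exact rpow_div_sinh_le hs hk1 (by omega)

theorem measurable_abs_sub_interpKernel (α : ℝ) (n : ℕ) :
    Measurable fun s => |s ^ α / Real.sinh s - interpKernel α n s| :=
  (((measurable_id.pow_const α).div Real.measurable_sinh).sub (measurable_interpKernel α n)).norm

-- The limit inherits the bound G; both terms lie in [0, G], so their difference does not exceed G.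
open Filter Set in
theorem abs_sub_interpKernel_le {α : ℝ} {G : ℝ → ℝ}
    (hle : ∀ᶠ n in atTop, ∀ s ∈ Ioi (0 : ℝ), interpKernel α n s ≤ G s) {n : ℕ} {s : ℝ}
    (hs : 0 < s) (hn : interpKernel α n s ≤ G s) :
    |s ^ α / Real.sinh s - interpKernel α n s| ≤ G s := by
  have h1 := interpKernel_nonneg α n hs
  have h2 : s ^ α / Real.sinh s ≤ G s :=
    le_of_tendsto (tendsto_interpKernel α hs) (hle.mono fun n hn => hn s hs)
  have h3 : 0 ≤ s ^ α / Real.sinh s :=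
    div_nonneg (Real.rpow_nonneg hs.le _) (Real.sinh_nonneg_iff.2 hs.le)
  rw [abs_le]
  constructor <;> linarith

open MeasureTheory Set Filter Topology in
theorem tendsto_integral_abs_sub_interpKernel {α : ℝ} {G : ℝ → ℝ}
    (hG : IntegrableOn G (Ioi 0))
    (hle : ∀ᶠ n in atTop, ∀ s ∈ Ioi (0 : ℝ), interpKernel α n s ≤ G s) :
    Tendsto (fun n : ℕ => ∫ s in Ioi (0 : ℝ), |s ^ α / Real.sinh s - interpKernel α n s|)
      atTop (𝓝 0) := by
  have h := tendsto_integral_filter_of_dominated_convergence (μ := volume.restrict (Ioi (0 : ℝ)))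
    (F := fun (n : ℕ) s => |s ^ α / Real.sinh s - interpKernel α n s|) (f := fun _ => 0)
    (l := atTop) G
    (Eventually.of_forall fun n => (measurable_abs_sub_interpKernel α n).aestronglyMeasurable)
    ?_ hG ?_
  · simpa using h
  · filter_upwards [hle] with n hn
    filter_upwards [ae_restrict_mem measurableSet_Ioi] with s hs
    rw [Real.norm_eq_abs, abs_abs]
    exact abs_sub_interpKernel_le hle hs (hn s hs)
  · filter_upwards [ae_restrict_mem measurableSet_Ioi] with s hs
    have := (tendsto_const_nhds (x := s ^ α / Real.sinh s)).sub (tendsto_interpKernel α hs)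
    simpa using this.abs

-- The difference of integrands splits into a kernel error times a factor at most 1 and a kernel at
-- most G times a factor at most ε; neither bound depends on x.
open MeasureTheory Set in
theorem abs_bigH_sub_integral_le {α ε x S : ℝ} (hα : 0 < α) (hε : 0 < ε) (hx : 0 ≤ x) {n : ℕ}
    {G : ℝ → ℝ} (hG : IntegrableOn G (Ioi 0)) (hn : ∀ s ∈ Ioi (0 : ℝ), interpKernel α n s ≤ G s)
    (hint : IntegrableOn (fun s => |s ^ α / Real.sinh s - interpKernel α n s|) (Ioi 0))
    (hS : |S - Real.sin x| ≤ ε * x) :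
    |bigH α x - ∫ s in Ioi (0 : ℝ), interpKernel α n s * (x * S / (x ^ 2 + s ^ 2))| ≤
      (∫ s in Ioi (0 : ℝ), |s ^ α / Real.sinh s - interpKernel α n s|) +
        ε * ∫ s in Ioi (0 : ℝ), G s := by
  have hsin : |Real.sin x| ≤ 1 * x := by
    simpa [abs_of_nonneg hx] using Real.abs_sin_le_abs (x := x)
  have hS' : |S| ≤ (1 + ε) * x := by
    have := abs_sub_abs_le_abs_sub S (Real.sin x)
    linarith
  have hK : IntegrableOn
      (fun s => interpKernel α n s * (x * S / (x ^ 2 + s ^ 2))) (Ioi 0) := by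
    refine Integrable.mono' (hG.mul_const (1 + ε)) ?_ ?_
    · exact ((measurable_interpKernel α n).mul (by fun_prop)).aestronglyMeasurable
    · filter_upwards [ae_restrict_mem measurableSet_Ioi] with s hs
      have h0 := interpKernel_nonneg α n hs
      rw [norm_mul, Real.norm_of_nonneg h0]
      exact mul_le_mul (hn s hs) (abs_mul_div_sq_add_sq_le (by positivity) hx hs hS')
        (abs_nonneg _) (h0.trans (hn s hs))
  rw [bigH, ← integral_sub (bigH_integrableOn α x hα) hK, ← integral_const_mul,
    ← integral_add hint (hG.const_mul ε)]
  rw [← Real.norm_eq_abs]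
  refine norm_integral_le_of_norm_le (hint.add (hG.const_mul ε)) ?_
  filter_upwards [ae_restrict_mem measurableSet_Ioi] with s hs
  have h0 := interpKernel_nonneg α n hs
  have e : s ^ α / Real.sinh s * (x * Real.sin x / (x ^ 2 + s ^ 2)) -
      interpKernel α n s * (x * S / (x ^ 2 + s ^ 2)) =
      (s ^ α / Real.sinh s - interpKernel α n s) * (x * Real.sin x / (x ^ 2 + s ^ 2)) -
        interpKernel α n s * (x * (S - Real.sin x) / (x ^ 2 + s ^ 2)) := by ring
  rw [e]
  refine (norm_sub_le _ _).trans (add_le_add ?_ ?_)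
  · rw [norm_mul]
    exact mul_le_of_le_one_right (norm_nonneg _)
      (abs_mul_div_sq_add_sq_le zero_le_one hx hs hsin)
  · rw [norm_mul, Real.norm_of_nonneg h0, mul_comm ε]
    exact mul_le_mul (hn s hs) (abs_mul_div_sq_add_sq_le hε.le hx hs hS)
      (abs_nonneg _) (h0.trans (hn s hs))

/-! ### Uniform convergence -/

theorem theorem3p2 (α : ℝ) (hα : 0 < α) (K : Set ℝ) (hK : IsCompact K)
    (hK0 : K ⊆ Set.Ici 0) :
    TendstoUniformlyOn
      (fun (n : ℕ) (x : ℝ) =>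
        (2 * (n : ℝ)) ^ α * (interpPoly α n).eval (x / (2 * (n : ℝ))))
      (limitH α) Filter.atTop K := by
  obtain ⟨R, hR⟩ := hK.bddAbove
  obtain ⟨G, hG, hle⟩ := exists_integrable_bound_interpKernel hα
  have hlim := tendsto_integral_abs_sub_interpKernel hG hle
  rw [Metric.tendstoUniformlyOn_iff]
  intro ε hε
  set I := ∫ s in Set.Ioi (0 : ℝ), G s with hI
  -- Makes the sine error contribute at most ε/2 after multiplication by I; the + 1 avoids dividing
  -- by zero.
  have hd : 0 < ε / (2 * (|I| + 1)) := by positivity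
  filter_upwards [hle, hlim.eventually (gt_mem_nhds (half_pos hε)),
    eventually_abs_sin_arcsin_sub_le R hd, Filter.eventually_ge_atTop 1,
    Filter.eventually_ge_atTop ⌈α⌉₊, Filter.eventually_ge_atTop ⌈R⌉₊] with n hn hnI hnS hn1 hnα hnR
    x hxK
  have hx0 : 0 ≤ x := hK0 hxK
  have hxR : x ≤ R := hR hxK
  have hRn : R ≤ n := Nat.ceil_le.1 hnR
  have herr := scaled_interpPoly_error hα hn1 (Nat.ceil_le.1 hnα) hx0
    (by linarith [n.cast_nonneg (α := ℝ)] : x ≤ 2 * n)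
  have hint : MeasureTheory.IntegrableOn
      (fun s => |s ^ α / Real.sinh s - interpKernel α n s|) (Set.Ioi 0) := by
    refine MeasureTheory.Integrable.mono' hG
      (measurable_abs_sub_interpKernel α n).aestronglyMeasurable ?_
    filter_upwards [MeasureTheory.ae_restrict_mem measurableSet_Ioi] with s hs
    rw [Real.norm_eq_abs, abs_abs]
    exact abs_sub_interpKernel_le hle hs (hn s hs)
  have hb := abs_bigH_sub_integral_le hα hd hx0 hG hn hint (hnS x ⟨hx0, hxR⟩)
  simp only [interpKernel] at hb hnI
  set J := ∫ s in Set.Ioi (0 : ℝ),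
    s ^ α / Real.sinh ((2 * n + 1) * Real.arsinh (s / (2 * n))) *
      (x * Real.sin ((2 * n + 1) * Real.arcsin (x / (2 * n))) / (x ^ 2 + s ^ 2)) with hJ
  have hc : |2 / Real.pi * Real.sin (Real.pi * α / 2)| ≤ 1 := by
    rw [abs_mul, abs_of_pos (by positivity)]
    exact mul_le_one₀ ((div_le_one Real.pi_pos).2 Real.two_le_pi) (abs_nonneg _)
      (Real.abs_sin_le_one _)
  have e : limitH α x - (2 * (n : ℝ)) ^ α * (interpPoly α n).eval (x / (2 * (n : ℝ))) =
      -(2 / Real.pi * Real.sin (Real.pi * α / 2)) * (bigH α x - J) := by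
    rw [limitH]
    linear_combination herr
  have hεI : ε / (2 * (|I| + 1)) * I ≤ ε / 2 := by
    rw [div_mul_eq_mul_div, div_le_div_iff₀ (by positivity) two_pos]
    nlinarith [le_abs_self I]
  rw [Real.dist_eq, e, abs_mul, abs_neg]
  calc _ ≤ 1 * |bigH α x - J| := mul_le_mul_of_nonneg_right hc (abs_nonneg _)
    _ < ε := by linarith
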